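/- Let $G$ be a multi-graph with $n\ge 2$ vertices and at most $m$ multi-edges, where $m\ge 2$, let $\epsilon\in(0,1]$, and let $Q$ be a set of multi-edges of $G$. All logarithms are to base $2$. For a multi-graph $H$ and a multi-edge $e=(u,v)$ of $H$, let \[ R_{\mathrm{eff},H}(e)=\sup_{x}\frac{(x_u-x_v)^2}{\sum_{(a,b)\in H}(x_a-x_b)^2} \] denote the effective resistance between the endpoints of $e$ in $H$ (unit weights; the supremum is over all vertex potentials $x$, with $0/0=0$). The recursive recovery procedure with $L$ levels, where $L$ is $\log m$ rounded up or down to an integer, is the following. Set $G_1=G$. For $i=1,\dots,L$, choose a set $F_i$ of multi-edges with \[ \Big\{e\in G_i:\ R_{\mathrm{eff},G_i}(e)\ \ge\ \frac{\epsilon^2}{1000\,\log n\,\log^2 m}\Big\}\subseteq F_i , \] and let $G_{i+1}$ be obtained from $G_i-F_i$ by keeping each multi-edge independently with probability $1/2$. Return $S=F_1\cup\dots\cup F_L$. Here $F_i$ may be chosen arbitrarily subject to the displayed inclusion, possibly at random and depending on $G_1,F_1,\dots,G_{i-1},F_{i-1},G_i$. Then, however the sets $F_i$ are chosen, \[ \Pr[S\cap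 Q\ne\emptyset]\ \ge\ \min\Big(\tfrac23,\ \frac{1}{\epsilon^2}\sum_{e\in Q}R_{\mathrm{eff},G}(e)\Big)-\frac{\log m}{n^{20}} . \] The same bound holds for the spanner version of the procedure, in which $F_i=T_1\cup\dots\cup T_\ell$ for an arbitrary disjoint collection of $\ell\ge 1000\log^2 n\,\log^2 m/\epsilon^2$ many $\log n$-spanners of $G_i$. That is, for each $j$, $T_j$ is a subgraph of $G_i-T_1-\dots-T_{j-1}$ in which all distances between vertices are at most $\log n$ times those in $G_i-T_1-\dots-T_{j-1}$. -/

import Mathlib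

open scoped Graph ENNReal

namespace RecursiveRecovery

/-! Multi-graphs are Mathlib's `Graph α β` (vertices in `α`, edge labels in `β`). All graphs that the
procedure meets have the vertex set of one fixed multi-graph `G`, and are given by the finite
set `A ⊆ E(G)` of their multi-edges. -/

open Classical in
/-- The energy `(x u - x v) ^ 2` of the multi-edge `e = (u, v)` under the vertex potential `x`
(and `0` if `e` is not a multi-edge of `G`). -/
noncomputable def edgeEnergy {α β : Type*} (G : Graph α β) (x : α → ℝ) (e : β) : ℝ :=
  if h : ∃ p : α × α, G.IsLink e p.1 p.2 then (x h.choose.1 - x h.choose.2) ^ 2 else 0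

theorem edgeEnergy_of_isLink {α β : Type*} {G : Graph α β} {e : β} {u v : α}
    (h : G.IsLink e u v) (x : α → ℝ) : edgeEnergy G x e = (x u - x v) ^ 2 := by
  have h' : ∃ p : α × α, G.IsLink e p.1 p.2 := ⟨(u, v), h⟩
  rw [edgeEnergy, dif_pos h']
  rcases h.eq_and_eq_or_eq_and_eq h'.choose_spec with ⟨h1, h2⟩ | ⟨h1, h2⟩
  · rw [← h1, ← h2]
  · rw [← h1, ← h2]; ring

/-- The energy of the potential `x` in the multi-graph with multi-edges `A` (of unit weight). -/
noncomputable def energy {α β : Type*} (G : Graph α β) (A : Finset β) (x : α → ℝ) : ℝ :=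
  ∑ f ∈ A, edgeEnergy G x f

/-- The effective resistance of the multi-edge `e ∈ A` in the multi-graph with multi-edges `A`:
the maximum over all vertex potentials of the fraction of the energy contributed by `e`. -/
noncomputable def effRes {α β : Type*} (G : Graph α β) (A : Finset β) (e : β) : ℝ :=
  ⨆ x : α → ℝ, edgeEnergy G x e / energy G A x

/-- Sampling at rate `1 / 2`: each multi-edge of `B` is kept independently with probability `1 / 2`,
so that the result is a uniformly random subset of `B`. -/
noncomputable def sampleHalf {β : Type*} (B : Finset β) : PMF (Finset β) :=
  PMF.uniformOfFinset B.powerset ⟨∅, Finset.empty_mem_powerset B⟩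

/-- A way to choose the sets `F i`: from the pairs `(G j, F j)` of the earlier levels, most recent
first, and from the current multi-edges `G i` it produces `F i`, possibly at random. -/
abbrev Rule (β : Type*) := List (Finset β × Finset β) → Finset β → PMF (Finset β)

/-- The law of the output of the recovery procedure with `L` remaining levels, past levels `past`
and current multi-edges `A`: on each level choose `F`, sample `A \ F` at rate `1 / 2` to get the
multi-edges of the next level, and return the union of all the sets `F`. -/
noncomputable def recover {β : Type*} [DecidableEq β] (rule : Rule β) :
    ℕ → List (Finset β × Finset β) → Finset β → PMF (Finset β)
  | 0, _, _ => PMF.pure ∅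
  | L + 1, past, A =>
      (rule past A).bind fun F =>
        (sampleHalf (A \ F)).bind fun A' =>
          (recover rule L ((A, F) :: past) A').map fun S => F ∪ S

/-- Whatever the rule chooses contains all multi-edges whose effective resistance in the current
multi-graph is at least `θ`. -/
def Rule.RecoversHeavy {α β : Type*} (rule : Rule β) (G : Graph α β) (E : Finset β) (θ : ℝ) :
    Prop :=
  ∀ (past : List (Finset β × Finset β)) (A : Finset β), A ⊆ E →
    ∀ F ∈ (rule past A).support, ∀ e ∈ A, θ ≤ effRes G A e → e ∈ F

/-- The simple graph whose adjacency is that of the multi-graph with multi-edges `A`. -/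
def adjGraph {α β : Type*} (G : Graph α β) (A : Finset β) : SimpleGraph α :=
  SimpleGraph.fromRel fun u v => ∃ e ∈ A, G.IsLink e u v

/-- `T` is a `t`-spanner of the multi-graph with multi-edges `A`: distances (which are infinite
between different components) grow at most by the factor `t`. -/
def IsSpanner {α β : Type*} (G : Graph α β) (t : ℝ) (A T : Finset β) : Prop :=
  T ⊆ A ∧ ∀ u ∈ V(G), ∀ v ∈ V(G),
    ((adjGraph G T).edist u v : ℝ≥0∞) ≤ ENNReal.ofReal t * ((adjGraph G A).edist u v : ℝ≥0∞)

/-- `T 0, …, T (ℓ - 1)` is a disjoint collection of `t`-spanners of the multi-graph with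
multi-edges `A`: each `T i` is a `t`-spanner of what the earlier ones leave. -/
def IsDisjointSpanners {α β : Type*} [DecidableEq β] (G : Graph α β) (t : ℝ) (A : Finset β)
    {ℓ : ℕ} (T : Fin ℓ → Finset β) : Prop :=
  ∀ i, IsSpanner G t (A \ (Finset.Iio i).biUnion T) (T i)

/-- Whatever the rule chooses is the union of a disjoint collection of `ℓ` many `t`-spanners of the
current multi-graph. -/
def Rule.RecoversSpanners {α β : Type*} [DecidableEq β] (rule : Rule β) (G : Graph α β)
    (E : Finset β) (t : ℝ) (ℓ : ℕ) : Prop :=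
  ∀ (past : List (Finset β × Finset β)) (A : Finset β), A ⊆ E →
    ∀ F ∈ (rule past A).support,
      ∃ T : Fin ℓ → Finset β, IsDisjointSpanners G t A T ∧ F = Finset.univ.biUnion T

/-- The probability that the output of the procedure, run with `L` levels on the multi-graph with
multi-edges `E`, intersects `Q`. -/
noncomputable def hitProb {β : Type*} [DecidableEq β] (rule : Rule β) (L : ℕ) (E Q : Finset β) :
    ℝ :=
  ((recover rule L [] E).toOuterMeasure {S | (S ∩ Q).Nonempty}).toReal

end RecursiveRecovery

/-!
Spanners reduce to resistances: a multi-edge outside `ℓ` disjoint `log n`-spanners is bypassed by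
`ℓ` edge-disjoint paths of length at most `log n`, so its effective resistance is below
`log n / ℓ` (`IsDisjointSpanners.effRes_le`). It remains to treat rules that recover all multi-edges
of resistance at least `θ = ε ^ 2 / (1000 * log n * (log m) ^ 2)`.

Suppose that a level recovers nothing of `Q`. All multi-edges that are then sampled are light. On the
space of gradients a multi-edge `e` is represented by a vector `v e` with `‖v e‖ ^ 2` at most its
effective resistance, and the energy of the sample is at most half the old energy plus half the form
of the signed sum `∑ ± v e (v e)ᵀ`. Its even moments obey a noncommutative Khintchine inequality,
proved by flipping one sign at a time (`sum_trace_pow_signedSum_succ_le`), so with probability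
`1 - 1 / n ^ 20` all energies become at most `(1 + t) / 2` times the old ones, for some `t` of order
`1 / log m` (`card_filter_not_energy_le`). Then all resistances grow at least by the factor
`2 / (1 + t)`.

Let `Z` be the total resistance of the multi-edges of `Q` in the current multi-graph. Sampling keeps
each of them with probability `1 / 2` and roughly doubles its resistance, and each contributes at
most `θ`; hence the mean of `exp (-s * Z)` after a level is at most `exp (-s' * Z)` with `s'` only a
factor `1 - O(1 / log m)` smaller than `s` (`sum_exp_neg_le`). A multi-edge of `Q` that is not a loop
starts with resistance at least `1 / m`, so if it survived to the last level, it would be heavy there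
and be recovered. Backward induction over the levels (`toOuterMeasure_missSet_le`) bounds the
probability of missing `Q` by `exp (-3 * Z / ε ^ 2) + log m / n ^ 20`.
-/

namespace RecursiveRecovery

/-! ### Signed sums of rank-one operators -/

section SignedSums

variable {β : Type*} [DecidableEq β]
  {H : Type*} [NormedAddCommGroup H] [InnerProductSpace ℝ H]

/-- The sign `±1` that a random subset `B` assigns to `e`. -/
def memSign (B : Finset β) (e : β) : ℝ := if e ∈ B then 1 else -1

theorem memSign_mul_self (B : Finset β) (e : β) : memSign B e * memSign B e = 1 := by
  unfold memSign; split_ifs <;> norm_num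

theorem memSign_symmDiff_self (B : Finset β) (e : β) :
    memSign (symmDiff B {e}) e = -memSign B e := by
  unfold memSign; by_cases h : e ∈ B <;> simp [h, Finset.mem_symmDiff]

theorem memSign_symmDiff_of_ne (B : Finset β) {e f : β} (h : f ≠ e) :
    memSign (symmDiff B {e}) f = memSign B f := by
  unfold memSign; simp [h, Finset.mem_symmDiff]

/-- The operator `∑ e ∈ C, ± v e (v e)ᵀ`, with sign `+` on `B` and `-` off `B`. For `B` uniform
among the subsets of `C` the signs are independent and uniform. -/
noncomputable def signedSum (v : β → H) (C B : Finset β) : H →ₗ[ℝ] H :=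
  ∑ e ∈ C, memSign B e • (InnerProductSpace.rankOne ℝ (v e) (v e)).toLinearMap

theorem signedSum_apply (v : β → H) (C B : Finset β) (h : H) :
    signedSum v C B h = ∑ e ∈ C, (memSign B e * inner ℝ (v e) h) • v e := by
  simp [signedSum, LinearMap.sum_apply, InnerProductSpace.rankOne_apply, smul_smul]

theorem isSymmetric_signedSum (v : β → H) (C B : Finset β) : (signedSum v C B).IsSymmetric := by
  intro x y
  rw [signedSum_apply, signedSum_apply, sum_inner, inner_sum]
  refine Finset.sum_congr rfl fun e _ => ?_
  rw [inner_smul_left, inner_smul_right, real_inner_comm (v e) x]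
  simp
  ring

theorem inner_signedSum_self (v : β → H) (C B : Finset β) (h : H) :
    inner ℝ h (signedSum v C B h) = ∑ e ∈ C, memSign B e * inner ℝ (v e) h ^ 2 := by
  rw [signedSum_apply, inner_sum]
  refine Finset.sum_congr rfl fun e _ => ?_
  rw [inner_smul_right, real_inner_comm, mul_assoc, sq]

theorem signedSum_sub_symmDiff (v : β → H) {C : Finset β} (B : Finset β) {e : β} (he : e ∈ C) :
    signedSum v C B - signedSum v C (symmDiff B {e})
      = (2 * memSign B e) • (InnerProductSpace.rankOne ℝ (v e) (v e)).toLinearMap := by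
  rw [signedSum, signedSum, ← Finset.sum_sub_distrib, Finset.sum_eq_single_of_mem e he]
  · rw [memSign_symmDiff_self, ← sub_smul]; congr 1; ring
  · intro f _ hf
    rw [memSign_symmDiff_of_ne B hf, sub_self]

end SignedSums

/-! ### Moments of symmetric operators -/

theorem pow_mul_pow_add_pow_mul_pow_le (a b : ℝ) {q r : ℕ} (h : Even (q + r)) :
    a ^ q * b ^ r + a ^ r * b ^ q ≤ a ^ (q + r) + b ^ (q + r) := by
  suffices 0 ≤ (a ^ q - b ^ q) * (a ^ r - b ^ r) by rw [pow_add, pow_add]; nlinarith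
  rcases Nat.even_or_odd q with hq | hq
  · have hr : Even r := (Nat.even_add.mp h).mp hq
    rw [← hq.pow_abs a, ← hq.pow_abs b, ← hr.pow_abs a, ← hr.pow_abs b]
    rcases le_total |a| |b| with hab | hab
    · exact mul_nonneg_of_nonpos_of_nonpos
        (sub_nonpos.2 (pow_le_pow_left₀ (abs_nonneg a) hab q))
        (sub_nonpos.2 (pow_le_pow_left₀ (abs_nonneg a) hab r))
    · exact mul_nonneg
        (sub_nonneg.2 (pow_le_pow_left₀ (abs_nonneg b) hab q))
        (sub_nonneg.2 (pow_le_pow_left₀ (abs_nonneg b) hab r))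
  · have hr : Odd r := by
      rcases Nat.even_or_odd r with hr | hr
      · exact absurd ((Nat.even_add.mp h).mpr hr) (Nat.not_even_iff_odd.mpr hq)
      · exact hr
    rcases le_total a b with hab | hab
    · exact mul_nonneg_of_nonpos_of_nonpos
        (sub_nonpos.2 (hq.pow_le_pow.mpr hab)) (sub_nonpos.2 (hr.pow_le_pow.mpr hab))
    · exact mul_nonneg
        (sub_nonneg.2 (hq.pow_le_pow.mpr hab)) (sub_nonneg.2 (hr.pow_le_pow.mpr hab))

/-- The telescoping expansion of a difference of powers in a noncommutative ring. -/
theorem pow_succ_sub_pow_succ {R : Type*} [Ring R] (x y : R) (n : ℕ) :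
    x ^ (n + 1) - y ^ (n + 1) = ∑ q ∈ Finset.range (n + 1), x ^ q * (x - y) * y ^ (n - q) := by
  induction n with
  | zero => simp
  | succ n ih =>
    have h : x ^ (n + 2) - y ^ (n + 2)
        = x * (x ^ (n + 1) - y ^ (n + 1)) + (x - y) * y ^ (n + 1) := by
      rw [pow_succ' x (n + 1), pow_succ' y (n + 1)]; noncomm_ring
    rw [h, ih, Finset.sum_range_succ' _ (n + 1), Finset.mul_sum]
    simp [pow_succ', mul_assoc]

section Operators

variable {H : Type*} [NormedAddCommGroup H] [InnerProductSpace ℝ H] [FiniteDimensional ℝ H]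

theorem pow_apply_eigenvectorBasis {T : H →ₗ[ℝ] H} (hT : T.IsSymmetric)
    (i : Fin (Module.finrank ℝ H)) (q : ℕ) :
    (T ^ q) (hT.eigenvectorBasis rfl i)
      = hT.eigenvalues rfl i ^ q • hT.eigenvectorBasis rfl i := by
  induction q with
  | zero => simp
  | succ q ih =>
    rw [pow_succ', Module.End.mul_apply, ih, map_smul, hT.apply_eigenvectorBasis, smul_smul,
      pow_succ]
    simp

theorem inner_pow_apply_self {T : H →ₗ[ℝ] H} (hT : T.IsSymmetric) (v : H) (q : ℕ) :
    inner ℝ v ((T ^ q) v)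
      = ∑ i, hT.eigenvalues rfl i ^ q * inner ℝ (hT.eigenvectorBasis rfl i) v ^ 2 := by
  rw [← (hT.eigenvectorBasis rfl).sum_inner_mul_inner]
  refine Finset.sum_congr rfl fun i _ => ?_
  rw [← hT.pow q, pow_apply_eigenvectorBasis, inner_smul_left, real_inner_comm]
  simp
  ring

theorem trace_pow_eq_sum {T : H →ₗ[ℝ] H} (hT : T.IsSymmetric) (q : ℕ) :
    LinearMap.trace ℝ H (T ^ q) = ∑ i, hT.eigenvalues rfl i ^ q := by
  rw [LinearMap.trace_eq_sum_inner _ (hT.eigenvectorBasis rfl)]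
  refine Finset.sum_congr rfl fun i _ => ?_
  rw [pow_apply_eigenvectorBasis, inner_smul_right]
  simp

/-- A large quadratic form forces a large even moment. -/
theorem inner_apply_self_le_of_trace_pow_lt {T : H →ₗ[ℝ] H} (hT : T.IsSymmetric) {t : ℝ}
    (ht : 0 ≤ t) {p : ℕ} (h : LinearMap.trace ℝ H (T ^ (2 * p)) < t ^ (2 * p))
    (v : H) : inner ℝ v (T v) ≤ t * ‖v‖ ^ 2 := by
  have hev : ∀ i, hT.eigenvalues rfl i ≤ t := by
    intro i
    by_contra! hi
    have h1 : t ^ (2 * p) ≤ hT.eigenvalues rfl i ^ (2 * p) := pow_le_pow_left₀ ht hi.le _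
    have h2 : hT.eigenvalues rfl i ^ (2 * p) ≤ ∑ j, hT.eigenvalues rfl j ^ (2 * p) :=
      Finset.single_le_sum (f := fun j => hT.eigenvalues rfl j ^ (2 * p))
        (fun j _ => (even_two_mul p).pow_nonneg _) (Finset.mem_univ i)
    rw [trace_pow_eq_sum hT] at h
    linarith
  have h1 := inner_pow_apply_self hT v 1
  rw [pow_one] at h1
  rw [h1, ← (hT.eigenvectorBasis rfl).sum_sq_norm_inner_right v, Finset.mul_sum]
  refine Finset.sum_le_sum fun i _ => ?_
  rw [pow_one, Real.norm_eq_abs, sq_abs]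
  exact mul_le_mul_of_nonneg_right (hev i) (sq_nonneg _)

/-- The rank-one case of the trace inequality that drives the noncommutative Khintchine
inequality: in joint eigencoordinates it is `pow_mul_pow_add_pow_mul_pow_le`. -/
theorem inner_pow_mul_inner_pow_add_le {X Y : H →ₗ[ℝ] H} (hX : X.IsSymmetric)
    (hY : Y.IsSymmetric) (v : H) {q r : ℕ} (h : Even (q + r)) :
    inner ℝ v ((X ^ q) v) * inner ℝ v ((Y ^ r) v) + inner ℝ v ((X ^ r) v) * inner ℝ v ((Y ^ q) v)
      ≤ ‖v‖ ^ 2 * (inner ℝ v ((X ^ (q + r)) v) + inner ℝ v ((Y ^ (q + r)) v)) := by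
  have hx : ‖v‖ ^ 2 = ∑ i, inner ℝ (hX.eigenvectorBasis rfl i) v ^ 2 := by
    rw [← (hX.eigenvectorBasis rfl).sum_sq_norm_inner_right v]; simp
  have hy : ‖v‖ ^ 2 = ∑ i, inner ℝ (hY.eigenvectorBasis rfl i) v ^ 2 := by
    rw [← (hY.eigenvectorBasis rfl).sum_sq_norm_inner_right v]; simp
  rw [mul_add]
  nth_rw 1 [hy]
  rw [hx]
  simp only [inner_pow_apply_self hX, inner_pow_apply_self hY]
  rw [mul_comm (∑ i, inner ℝ (hY.eigenvectorBasis rfl i) v ^ 2)]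
  simp only [Finset.sum_mul_sum, ← Finset.sum_add_distrib]
  refine Finset.sum_le_sum fun i _ => Finset.sum_le_sum fun j _ => ?_
  have := mul_le_mul_of_nonneg_right (pow_mul_pow_add_pow_mul_pow_le
    (hX.eigenvalues rfl i) (hY.eigenvalues rfl j) h)
    (mul_nonneg (sq_nonneg (inner ℝ (hX.eigenvectorBasis rfl i) v))
      (sq_nonneg (inner ℝ (hY.eigenvectorBasis rfl j) v)))
  nlinarith [this]

theorem sum_inner_pow_mul_inner_pow_le {X Y : H →ₗ[ℝ] H} (hX : X.IsSymmetric)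
    (hY : Y.IsSymmetric) (v : H) (k : ℕ) :
    2 * ∑ q ∈ Finset.range (2 * k + 1), inner ℝ v ((X ^ q) v) * inner ℝ v ((Y ^ (2 * k - q)) v)
      ≤ (2 * k + 1) *
        (‖v‖ ^ 2 * (inner ℝ v ((X ^ (2 * k)) v) + inner ℝ v ((Y ^ (2 * k)) v))) := by
  have hr := Finset.sum_range_reflect
    (fun q => inner ℝ v ((X ^ q) v) * inner ℝ v ((Y ^ (2 * k - q)) v)) (2 * k + 1)
  rw [two_mul (∑ q ∈ _, _)]
  nth_rw 2 [← hr]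
  rw [← Finset.sum_add_distrib]
  refine (Finset.sum_le_card_nsmul _ _
    (‖v‖ ^ 2 * (inner ℝ v ((X ^ (2 * k)) v) + inner ℝ v ((Y ^ (2 * k)) v)))
    fun q hq => ?_).trans ?_
  · have hq' : q ≤ 2 * k := Nat.lt_succ_iff.1 (Finset.mem_range.1 hq)
    have h := inner_pow_mul_inner_pow_add_le hX hY v (q := q) (r := 2 * k - q)
      (by rw [Nat.add_sub_cancel' hq']; exact even_two_mul k)
    rw [Nat.add_sub_cancel' hq'] at h
    have e1 : 2 * k + 1 - 1 - q = 2 * k - q := by omega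
    have e2 : 2 * k - (2 * k - q) = q := by omega
    rw [e1, e2]
    exact h
  · rw [Finset.card_range, nsmul_eq_mul]
    push_cast
    exact le_rfl

/-! ### A noncommutative Khintchine inequality for rank-one operators -/

/-- For a sub-Parseval system `v`, the weighted sum of quadratic forms of an even power is at most
its trace. -/
theorem sum_inner_pow_le_trace {β : Type*} (v : β → H) (C : Finset β)
    (hv : ∀ h : H, ∑ e ∈ C, inner ℝ (v e) h ^ 2 ≤ ‖h‖ ^ 2) {T : H →ₗ[ℝ] H}
    (hT : T.IsSymmetric) (k : ℕ) :
    ∑ e ∈ C, inner ℝ (v e) ((T ^ (2 * k)) (v e)) ≤ LinearMap.trace ℝ H (T ^ (2 * k)) := by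
  simp only [inner_pow_apply_self hT, trace_pow_eq_sum hT]
  rw [Finset.sum_comm]
  refine Finset.sum_le_sum fun i _ => ?_
  rw [← Finset.mul_sum]
  have h := hv (hT.eigenvectorBasis rfl i)
  rw [OrthonormalBasis.norm_eq_one, one_pow] at h
  have h' : ∑ e ∈ C, inner ℝ (hT.eigenvectorBasis rfl i) (v e) ^ 2 ≤ 1 :=
    (Finset.sum_congr rfl fun e _ => by rw [real_inner_comm]).trans_le h
  exact mul_le_of_le_one_right ((even_two_mul k).pow_nonneg _) h'

variable {β : Type*} [DecidableEq β]

theorem trace_pow_signedSum (v : β → H) (C B : Finset β) (q : ℕ) :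
    LinearMap.trace ℝ H (signedSum v C B ^ (q + 1))
      = ∑ e ∈ C, memSign B e * inner ℝ (v e) ((signedSum v C B ^ q) (v e)) := by
  set b := stdOrthonormalBasis ℝ H
  rw [LinearMap.trace_eq_sum_inner _ b]
  have h : ∀ i, inner ℝ (b i) ((signedSum v C B ^ (q + 1)) (b i)) = ∑ e ∈ C, memSign B e *
      (inner ℝ (v e) (b i) * inner ℝ (b i) ((signedSum v C B ^ q) (v e))) := by
    intro i
    rw [pow_succ, Module.End.mul_apply, signedSum_apply, map_sum, inner_sum]
    refine Finset.sum_congr rfl fun e _ => ?_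
    rw [map_smul, inner_smul_right, mul_assoc]
  simp only [h]
  rw [Finset.sum_comm]
  refine Finset.sum_congr rfl fun e _ => ?_
  rw [← Finset.mul_sum, b.sum_inner_mul_inner]

theorem sum_powerset_symmDiff (C : Finset β) {e : β} (he : e ∈ C) (g : Finset β → ℝ) :
    ∑ B ∈ C.powerset, g (symmDiff B {e}) = ∑ B ∈ C.powerset, g B := by
  have hmem : ∀ B ∈ C.powerset, symmDiff B {e} ∈ C.powerset := by
    intro B hB
    rw [Finset.mem_powerset] at hB ⊢
    intro x hx
    rcases Finset.mem_symmDiff.1 hx with ⟨h, _⟩ | ⟨h, _⟩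
    · exact hB h
    · rwa [Finset.mem_singleton.1 h]
  exact Finset.sum_bij' (fun B _ => symmDiff B {e}) (fun B _ => symmDiff B {e}) hmem hmem
    (fun B _ => symmDiff_symmDiff_cancel_right {e} B)
    (fun B _ => symmDiff_symmDiff_cancel_right {e} B) fun B _ => rfl

/-- Flipping the sign of `e` and telescoping gains one factor `‖v e‖ ^ 2` and loses two powers of
the operator: a discrete integration by parts. -/
theorem sum_memSign_mul_inner_pow_le (v : β → H) (C : Finset β) {e : β} (he : e ∈ C) (k : ℕ) :
    ∑ B ∈ C.powerset, memSign B e * inner ℝ (v e) ((signedSum v C B ^ (2 * k + 1)) (v e))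
      ≤ (2 * k + 1) * (‖v e‖ ^ 2 *
        ∑ B ∈ C.powerset, inner ℝ (v e) ((signedSum v C B ^ (2 * k)) (v e))) := by
  have hflip := sum_powerset_symmDiff C he fun B =>
    memSign B e * inner ℝ (v e) ((signedSum v C B ^ (2 * k + 1)) (v e))
  have hflip' := sum_powerset_symmDiff C he fun B =>
    inner ℝ (v e) ((signedSum v C B ^ (2 * k)) (v e))
  have key : ∀ B : Finset β,
      memSign B e * inner ℝ (v e) ((signedSum v C B ^ (2 * k + 1)) (v e))
        + memSign (symmDiff B {e}) e *
          inner ℝ (v e) ((signedSum v C (symmDiff B {e}) ^ (2 * k + 1)) (v e))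
      ≤ (2 * k + 1) * (‖v e‖ ^ 2 * (inner ℝ (v e) ((signedSum v C B ^ (2 * k)) (v e))
        + inner ℝ (v e) ((signedSum v C (symmDiff B {e}) ^ (2 * k)) (v e)))) := by
    intro B
    refine le_trans (le_of_eq ?_) (sum_inner_pow_mul_inner_pow_le (isSymmetric_signedSum v C B)
      (isSymmetric_signedSum v C (symmDiff B {e})) (v e) k)
    rw [memSign_symmDiff_self, neg_mul, ← sub_eq_add_neg, ← mul_sub, ← inner_sub_right,
      ← LinearMap.sub_apply, pow_succ_sub_pow_succ, signedSum_sub_symmDiff v B he,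
      LinearMap.sum_apply, inner_sum, Finset.mul_sum, Finset.mul_sum]
    refine Finset.sum_congr rfl fun q _ => ?_
    simp only [Module.End.mul_apply, LinearMap.smul_apply, map_smul, inner_smul_right,
      ContinuousLinearMap.coe_coe, InnerProductSpace.rankOne_apply]
    linear_combination (2 * inner ℝ (v e) ((signedSum v C B ^ q) (v e)) *
      inner ℝ (v e) ((signedSum v C (symmDiff B {e}) ^ (2 * k - q)) (v e)))
      * memSign_mul_self B e
  have hsum := Finset.sum_le_sum fun B (_ : B ∈ C.powerset) => key B
  rw [Finset.sum_add_distrib, hflip, ← Finset.mul_sum, ← Finset.mul_sum, Finset.sum_add_distrib,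
    hflip'] at hsum
  linarith

/-- Noncommutative Khintchine inequality for rank-one operators, one moment at a time. -/
theorem sum_trace_pow_signedSum_succ_le (v : β → H) (C : Finset β) {K : ℝ}
    (hv : ∀ h : H, ∑ e ∈ C, inner ℝ (v e) h ^ 2 ≤ ‖h‖ ^ 2) (hK : ∀ e ∈ C, ‖v e‖ ^ 2 ≤ K)
    (hK0 : 0 ≤ K) (k : ℕ) :
    ∑ B ∈ C.powerset, LinearMap.trace ℝ H (signedSum v C B ^ (2 * (k + 1)))
      ≤ (2 * k + 1) * K *
        ∑ B ∈ C.powerset, LinearMap.trace ℝ H (signedSum v C B ^ (2 * k)) := by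
  have hnn : ∀ e B, 0 ≤ inner ℝ (v e) ((signedSum v C B ^ (2 * k)) (v e)) := fun e B => by
    rw [inner_pow_apply_self (isSymmetric_signedSum v C B)]
    exact Finset.sum_nonneg fun i _ =>
      mul_nonneg ((even_two_mul k).pow_nonneg _) (sq_nonneg _)
  calc ∑ B ∈ C.powerset, LinearMap.trace ℝ H (signedSum v C B ^ (2 * (k + 1)))
      = ∑ e ∈ C, ∑ B ∈ C.powerset,
          memSign B e * inner ℝ (v e) ((signedSum v C B ^ (2 * k + 1)) (v e)) := by
        rw [Finset.sum_comm]
        exact Finset.sum_congr rfl fun B _ => trace_pow_signedSum v C B (2 * k + 1)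
    _ ≤ ∑ e ∈ C, (2 * k + 1) * (K *
          ∑ B ∈ C.powerset, inner ℝ (v e) ((signedSum v C B ^ (2 * k)) (v e))) := by
        refine Finset.sum_le_sum fun e he => (sum_memSign_mul_inner_pow_le v C he k).trans ?_
        have := hK e he
        have h0 := Finset.sum_nonneg fun B (_ : B ∈ C.powerset) => hnn e B
        gcongr
    _ = (2 * k + 1) * K * ∑ B ∈ C.powerset, ∑ e ∈ C,
          inner ℝ (v e) ((signedSum v C B ^ (2 * k)) (v e)) := by
        rw [← Finset.mul_sum, ← Finset.mul_sum, Finset.sum_comm, mul_assoc]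
    _ ≤ _ := by
        have := fun B => sum_inner_pow_le_trace v C hv (isSymmetric_signedSum v C B) k
        gcongr with B hB
        exact this B

theorem sum_trace_pow_signedSum_le (v : β → H) (C : Finset β) {K : ℝ}
    (hv : ∀ h : H, ∑ e ∈ C, inner ℝ (v e) h ^ 2 ≤ ‖h‖ ^ 2) (hK : ∀ e ∈ C, ‖v e‖ ^ 2 ≤ K)
    (hK0 : 0 ≤ K) {p k : ℕ} (hk : k ≤ p) :
    ∑ B ∈ C.powerset, LinearMap.trace ℝ H (signedSum v C B ^ (2 * k))
      ≤ 2 ^ C.card * Module.finrank ℝ H * (2 * p * K) ^ k := by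
  induction k with
  | zero => simp
  | succ k ih =>
    refine (sum_trace_pow_signedSum_succ_le v C hv hK hK0 k).trans ?_
    have h1 := ih (by omega)
    have h2 : (2 * k + 1 : ℝ) ≤ 2 * p := by
      have : ((2 * k + 1 : ℕ) : ℝ) ≤ ((2 * p : ℕ) : ℝ) := by
        exact_mod_cast (by omega : 2 * k + 1 ≤ 2 * p)
      push_cast at this; exact this
    calc (2 * k + 1) * K * ∑ B ∈ C.powerset, LinearMap.trace ℝ H (signedSum v C B ^ (2 * k))
        ≤ (2 * p) * K * (2 ^ C.card * Module.finrank ℝ H * (2 * p * K) ^ k) := by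
          refine mul_le_mul (mul_le_mul_of_nonneg_right h2 hK0) h1
            (Finset.sum_nonneg fun B _ => ?_) (by positivity)
          rw [trace_pow_eq_sum (isSymmetric_signedSum v C B)]
          exact Finset.sum_nonneg fun i _ => (even_two_mul k).pow_nonneg _
      _ = _ := by ring

open Classical in
/-- Markov's inequality for the moment of order `2 * p`: the number of subsets of `C` for which the
signed sum is not bounded by `t`. -/
theorem card_filter_not_inner_signedSum_le (v : β → H) (C : Finset β) {K t : ℝ}
    (hv : ∀ h : H, ∑ e ∈ C, inner ℝ (v e) h ^ 2 ≤ ‖h‖ ^ 2) (hK : ∀ e ∈ C, ‖v e‖ ^ 2 ≤ K)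
    (hK0 : 0 ≤ K) (ht : 0 < t) (p : ℕ) :
    ((C.powerset.filter fun B =>
        ¬ ∀ h : H, inner ℝ h (signedSum v C B h) ≤ t * ‖h‖ ^ 2).card : ℝ)
      ≤ 2 ^ C.card * (Module.finrank ℝ H * (2 * p * K / t ^ 2) ^ p) := by
  have h1 := sum_trace_pow_signedSum_le v C hv hK hK0 (le_refl p)
  have hnn : ∀ B, 0 ≤ LinearMap.trace ℝ H (signedSum v C B ^ (2 * p)) := fun B => by
    rw [trace_pow_eq_sum (isSymmetric_signedSum v C B)]
    exact Finset.sum_nonneg fun i _ => (even_two_mul p).pow_nonneg _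
  have h2 : ((C.powerset.filter fun B =>
        ¬ ∀ h : H, inner ℝ h (signedSum v C B h) ≤ t * ‖h‖ ^ 2).card : ℝ) * t ^ (2 * p)
      ≤ ∑ B ∈ C.powerset, LinearMap.trace ℝ H (signedSum v C B ^ (2 * p)) := by
    rw [← nsmul_eq_mul]
    refine (Finset.card_nsmul_le_sum _ (fun B =>
      LinearMap.trace ℝ H (signedSum v C B ^ (2 * p))) _ fun B hB => ?_).trans
      (Finset.sum_le_sum_of_subset_of_nonneg (Finset.filter_subset _ _) fun B _ _ => hnn B)
    by_contra! hlt
    exact (Finset.mem_filter.1 hB).2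
      (inner_apply_self_le_of_trace_pow_lt (isSymmetric_signedSum v C B) ht.le hlt)
  have htp : 0 < t ^ (2 * p) := by positivity
  rw [div_pow, ← pow_mul, ← mul_div_assoc, ← mul_div_assoc, le_div_iff₀ htp, ← mul_assoc]
  exact h2.trans h1

end Operators

/-! ### Effective resistances -/

section EffectiveResistance

variable {α β : Type*} {G : Graph α β} {A B C : Finset β} {e : β}

open Classical in
/-- The potential difference `x u - x v` along the multi-edge `e = (u, v)`, as a linear form in the
potential `x`. The orientation is the one chosen in `edgeEnergy`. -/
noncomputable def edgeDiff (G : Graph α β) (e : β) : (α → ℝ) →ₗ[ℝ] ℝ :=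
  if h : ∃ p : α × α, G.IsLink e p.1 p.2 then
    LinearMap.proj (R := ℝ) (φ := fun _ : α => ℝ) h.choose.1 -
      LinearMap.proj (R := ℝ) (φ := fun _ : α => ℝ) h.choose.2
  else 0

theorem edgeEnergy_eq_sq_edgeDiff (x : α → ℝ) : edgeEnergy G x e = edgeDiff G e x ^ 2 := by
  unfold edgeEnergy edgeDiff
  split_ifs <;> simp

theorem edgeEnergy_nonneg (x : α → ℝ) : 0 ≤ edgeEnergy G x e := by
  rw [edgeEnergy_eq_sq_edgeDiff]; exact sq_nonneg _

theorem abs_edgeDiff_of_isLink {u v : α} (h : G.IsLink e u v) (x : α → ℝ) :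
    |edgeDiff G e x| = |x u - x v| := by
  rw [← sq_eq_sq_iff_abs_eq_abs, ← edgeEnergy_eq_sq_edgeDiff, edgeEnergy_of_isLink h]

theorem edgeDiff_congr {x y : α → ℝ} (h : ∀ a ∈ V(G), x a = y a) :
    edgeDiff G e x = edgeDiff G e y := by
  unfold edgeDiff
  split_ifs with h'
  · simp [h _ h'.choose_spec.left_mem, h _ h'.choose_spec.right_mem]
  · rfl

theorem energy_nonneg (x : α → ℝ) : 0 ≤ energy G A x :=
  Finset.sum_nonneg fun _ _ => edgeEnergy_nonneg x

theorem energy_mono (h : B ⊆ A) (x : α → ℝ) : energy G B x ≤ energy G A x :=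
  Finset.sum_le_sum_of_subset_of_nonneg h fun _ _ _ => edgeEnergy_nonneg x

theorem edgeEnergy_le_energy (he : e ∈ A) (x : α → ℝ) : edgeEnergy G x e ≤ energy G A x :=
  Finset.single_le_sum (f := fun f => edgeEnergy G x f) (fun _ _ => edgeEnergy_nonneg x) he

theorem le_effRes (he : e ∈ A) (x : α → ℝ) :
    edgeEnergy G x e / energy G A x ≤ effRes G A e := by
  refine le_ciSup (f := fun x => edgeEnergy G x e / energy G A x) ⟨1, ?_⟩ x
  rintro _ ⟨y, rfl⟩
  exact div_le_one_of_le₀ (edgeEnergy_le_energy he y) (energy_nonneg y)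

theorem effRes_le {c : ℝ} (hc : 0 ≤ c)
    (h : ∀ x, edgeEnergy G x e ≤ c * energy G A x) : effRes G A e ≤ c :=
  ciSup_le fun x => div_le_of_le_mul₀ (energy_nonneg x) hc (h x)

theorem edgeEnergy_le_effRes_mul (he : e ∈ A) (x : α → ℝ) :
    edgeEnergy G x e ≤ effRes G A e * energy G A x := by
  rcases (energy_nonneg (G := G) (A := A) x).eq_or_lt with h0 | h0
  · rw [← h0, mul_zero, h0]; exact edgeEnergy_le_energy he x
  · exact (div_le_iff₀ h0).1 (le_effRes he x)

theorem effRes_nonneg (he : e ∈ A) : 0 ≤ effRes G A e :=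
  (div_nonneg (edgeEnergy_nonneg 0) (energy_nonneg 0)).trans (le_effRes he 0)

theorem effRes_le_mul_effRes {c : ℝ} (hc : 0 ≤ c) (he : e ∈ B)
    (h : ∀ x, energy G B x ≤ c * energy G A x) : effRes G A e ≤ c * effRes G B e := by
  have h0 := effRes_nonneg (G := G) he
  refine effRes_le (by positivity) fun x => ?_
  calc edgeEnergy G x e ≤ effRes G B e * energy G B x := edgeEnergy_le_effRes_mul he x
    _ ≤ effRes G B e * (c * energy G A x) := by gcongr; exact h x
    _ = _ := by ring

theorem effRes_eq_zero_of_subset (hB : B ⊆ A) (he : e ∈ B) (h : effRes G A e = 0) :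
    effRes G B e = 0 :=
  le_antisymm (effRes_le le_rfl fun x => by
    simpa [h] using edgeEnergy_le_effRes_mul (G := G) (hB he) x) (effRes_nonneg he)

/-- With unit weights, the effective resistance of a multi-edge that is not a loop is at least the
inverse of the number of multi-edges: test with the indicator of an endpoint. -/
theorem effRes_eq_zero_or_inv_le (he : e ∈ A) {m : ℕ} (hm : A.card ≤ m) :
    effRes G A e = 0 ∨ (m : ℝ)⁻¹ ≤ effRes G A e := by
  classical
  by_cases hne : ∃ u v, u ≠ v ∧ G.IsLink e u v
  · right
    obtain ⟨u, v, huv, hl⟩ := hne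
    set x : α → ℝ := Pi.single u 1
    have h1 : edgeEnergy G x e = 1 := by
      rw [edgeEnergy_of_isLink hl]; simp [x, huv.symm]
    have hval : ∀ a, x a = 0 ∨ x a = 1 := fun a => by
      by_cases h : a = u
      · right; simp [x, h]
      · left; simp [x, h]
    have h2 : energy G A x ≤ m := by
      calc energy G A x ≤ ∑ f ∈ A, (1 : ℝ) := by
            refine Finset.sum_le_sum fun f _ => ?_
            unfold edgeEnergy
            split_ifs with h
            · rcases hval h.choose.1 with h1 | h1 <;> rcases hval h.choose.2 with h2 | h2 <;>
                rw [h1, h2] <;> norm_num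
            · exact zero_le_one
        _ = A.card := by simp
        _ ≤ m := by exact_mod_cast hm
    have h3 : 0 < energy G A x := by
      have := edgeEnergy_le_energy (G := G) he x
      linarith
    calc (m : ℝ)⁻¹ ≤ (energy G A x)⁻¹ := inv_anti₀ h3 h2
      _ = edgeEnergy G x e / energy G A x := by rw [h1, one_div]
      _ ≤ _ := le_effRes he x
  · left
    push Not at hne
    have h0 : ∀ x, edgeEnergy G x e = 0 := fun x => by
      unfold edgeEnergy
      split_ifs with h
      · have : h.choose.1 = h.choose.2 := by
          by_contra h'
          exact hne _ _ h' h.choose_spec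
        rw [this]; ring
      · rfl
    exact le_antisymm (effRes_le le_rfl fun x => by rw [h0, zero_mul]) (effRes_nonneg he)

/-! ### Sampling light multi-edges roughly halves all energies -/

/-- The map taking a potential to its differences along the multi-edges in `A`. -/
noncomputable def gradient (G : Graph α β) (A : Finset β) : (α → ℝ) →ₗ[ℝ] EuclideanSpace ℝ A :=
  (WithLp.linearEquiv 2 ℝ (A → ℝ)).symm.toLinearMap ∘ₗ LinearMap.pi fun e : A => edgeDiff G e

theorem gradient_apply (x : α → ℝ) (e : A) : gradient G A x e = edgeDiff G e x := rfl

theorem norm_sq_gradient (x : α → ℝ) : ‖gradient G A x‖ ^ 2 = energy G A x := by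
  rw [EuclideanSpace.norm_sq_eq, energy, ← Finset.sum_coe_sort A]
  refine Finset.sum_congr rfl fun e _ => ?_
  rw [gradient_apply, Real.norm_eq_abs, sq_abs, edgeEnergy_eq_sq_edgeDiff]

theorem finrank_range_gradient_le {n : ℕ} (hV : V(G).encard = n) :
    Module.finrank ℝ (gradient G A).range ≤ n := by
  have hfin : V(G).Finite := Set.finite_of_encard_eq_coe hV
  have := hfin.fintype
  have hle : (gradient G A).range
      ≤ (gradient G A ∘ₗ Function.ExtendByZero.linearMap ℝ ((↑) : V(G) → α)).range := by
    rintro _ ⟨x, rfl⟩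
    refine ⟨fun a => x a, ?_⟩
    ext e
    rw [LinearMap.comp_apply, gradient_apply, gradient_apply]
    refine edgeDiff_congr fun a ha => ?_
    exact Subtype.val_injective.extend_apply (fun a : V(G) => x a) 0 ⟨a, ha⟩
  calc Module.finrank ℝ (gradient G A).range
      ≤ Module.finrank ℝ
        (gradient G A ∘ₗ Function.ExtendByZero.linearMap ℝ ((↑) : V(G) → α)).range :=
        Submodule.finrank_mono hle
    _ ≤ Module.finrank ℝ (V(G) → ℝ) := LinearMap.finrank_range_le _
    _ = n := by
        rw [Module.finrank_fintype_fun_eq_card, ← Nat.card_eq_fintype_card, Nat.card_coe_set_eq,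
          Set.ncard, hV]
        rfl

open Classical in
/-- The vector representing `edgeDiff G e` on the space of gradients: the projection of the
coordinate vector at `e`. Its squared length is the effective resistance of `e`. -/
noncomputable def edgeVector (G : Graph α β) (A : Finset β) (e : β) : (gradient G A).range :=
  if h : e ∈ A then
    (gradient G A).range.orthogonalProjectionOnto (EuclideanSpace.single ⟨e, h⟩ 1) else 0

theorem inner_edgeVector (he : e ∈ A) (x : α → ℝ) :
    inner ℝ (edgeVector G A e) ⟨gradient G A x, x, rfl⟩ = edgeDiff G e x := by
  classical
  rw [edgeVector, dif_pos he, Submodule.inner_orthogonalProjectionOnto_eq_of_mem_right,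
    EuclideanSpace.inner_single_left, gradient_apply]
  simp

theorem norm_sq_edgeVector_le (he : e ∈ A) : ‖edgeVector G A e‖ ^ 2 ≤ effRes G A e := by
  obtain ⟨x, hx⟩ := (edgeVector G A e).2
  have hx' : edgeVector G A e = ⟨gradient G A x, x, rfl⟩ := Subtype.ext hx.symm
  have h1 : ‖edgeVector G A e‖ ^ 2 = edgeDiff G e x := by
    rw [← inner_edgeVector he x, ← hx', real_inner_self_eq_norm_sq]
  have h2 : ‖edgeVector G A e‖ ^ 2 = energy G A x := by
    rw [← norm_sq_gradient, hx]; rfl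
  have h3 := edgeEnergy_le_effRes_mul (G := G) he x
  rw [edgeEnergy_eq_sq_edgeDiff, ← h1, ← h2] at h3
  rcases (sq_nonneg ‖edgeVector G A e‖).eq_or_lt with h0 | h0
  · rw [← h0]; exact effRes_nonneg he
  · exact le_of_mul_le_mul_right (by rwa [sq] at h3) h0

theorem sum_sq_inner_edgeVector (hB : B ⊆ A) (x : α → ℝ) :
    ∑ e ∈ B, inner ℝ (edgeVector G A e) ⟨gradient G A x, x, rfl⟩ ^ 2 = energy G B x :=
  Finset.sum_congr rfl fun e he => by
    rw [inner_edgeVector (hB he), edgeEnergy_eq_sq_edgeDiff]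

theorem energy_le_of_inner_signedSum_le [DecidableEq β] (hC : C ⊆ A) (hB : B ⊆ C) {t : ℝ}
    (h : ∀ w, inner ℝ w (signedSum (edgeVector G A) C B w) ≤ t * ‖w‖ ^ 2) (x : α → ℝ) :
    energy G B x ≤ (1 + t) / 2 * energy G A x := by
  set w : (gradient G A).range := ⟨gradient G A x, x, rfl⟩ with hw
  have h1 : inner ℝ w (signedSum (edgeVector G A) C B w)
      = 2 * energy G B x - energy G C x := by
    rw [inner_signedSum_self, ← sum_sq_inner_edgeVector (hB.trans hC),
      ← sum_sq_inner_edgeVector hC, ← Finset.sum_sdiff hB, ← Finset.sum_sdiff hB]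
    have e1 : ∀ e ∈ C \ B, memSign B e * inner ℝ (edgeVector G A e) w ^ 2
        = - inner ℝ (edgeVector G A e) w ^ 2 := fun e he => by
      rw [memSign, if_neg (Finset.mem_sdiff.1 he).2]; ring
    have e2 : ∀ e ∈ B, memSign B e * inner ℝ (edgeVector G A e) w ^ 2
        = inner ℝ (edgeVector G A e) w ^ 2 := fun e he => by
      rw [memSign, if_pos he]; ring
    rw [Finset.sum_congr rfl e1, Finset.sum_congr rfl e2, Finset.sum_neg_distrib]
    ring
  have h2 := h w
  have h3 : ‖w‖ ^ 2 = energy G A x := norm_sq_gradient x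
  rw [h1, h3] at h2
  have h4 := energy_mono (G := G) hC x
  linarith

open Classical in
/-- Spectral concentration: if all multi-edges in `C ⊆ A` are light, then for most subsets of `C`
all energies are at most slightly more than half of those in `A`. -/
theorem card_filter_not_energy_le [DecidableEq β] {n : ℕ} (hV : V(G).encard = n) (hC : C ⊆ A)
    {θ t : ℝ} (hθ : 0 ≤ θ) (hlight : ∀ e ∈ C, effRes G A e ≤ θ) (ht : 0 < t) (p : ℕ) :
    ((C.powerset.filter fun B =>
        ¬ ∀ x, energy G B x ≤ (1 + t) / 2 * energy G A x).card : ℝ)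
      ≤ 2 ^ C.card * (n * (2 * p * θ / t ^ 2) ^ p) := by
  have h := card_filter_not_inner_signedSum_le (edgeVector G A) C (K := θ) (t := t)
    (by
      rintro ⟨_, x, rfl⟩
      rw [sum_sq_inner_edgeVector hC x]
      exact (energy_mono hC x).trans_eq (norm_sq_gradient x).symm)
    (fun e he => (norm_sq_edgeVector_le (hC he)).trans (hlight e he)) hθ ht p
  refine le_trans ?_ (h.trans ?_)
  · refine Nat.cast_le.2 (Finset.card_le_card fun B hB => ?_)
    rw [Finset.mem_filter] at hB ⊢
    exact ⟨hB.1, fun hg => hB.2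
      (energy_le_of_inner_signedSum_le hC (Finset.mem_powerset.1 hB.1) hg)⟩
  · have := finrank_range_gradient_le (A := A) hV
    gcongr

/-! ### Disjoint spanners contain all heavy multi-edges -/

/-- A path in the simple graph lifts to a set of at most as many multi-edges, whose potential
differences bound that of the endpoints. The clause on supports keeps the lifted multi-edges
distinct along the induction. -/
theorem exists_subset_of_isPath {T : Finset β} {u v : α} (p : (adjGraph G T).Walk u v)
    (hp : p.IsPath) : ∃ P ⊆ T, P.card ≤ p.length ∧ (∀ f ∈ P, ∀ a, G.Inc f a → a ∈ p.support) ∧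
      ∀ x : α → ℝ, |x u - x v| ≤ ∑ f ∈ P, |edgeDiff G f x| := by
  classical
  induction p with
  | nil => exact ⟨∅, by simp, by simp, by simp, by simp⟩
  | @cons u w v h p ih =>
    rw [SimpleGraph.Walk.cons_isPath_iff] at hp
    obtain ⟨P, hPT, hcard, hinc, hP⟩ := ih hp.1
    obtain ⟨f, hfT, hf⟩ : ∃ f ∈ T, G.IsLink f u w := by
      rcases ((SimpleGraph.fromRel_adj _ _ _).1 h).2 with h | ⟨f, hf, hl⟩
      · exact h
      · exact ⟨f, hf, hl.symm⟩
    have hfP : f ∉ P := fun hfP => hp.2 (hinc f hfP u hf.inc_left)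
    refine ⟨insert f P, Finset.insert_subset hfT hPT, ?_, ?_, fun x => ?_⟩
    · rw [Finset.card_insert_of_notMem hfP, SimpleGraph.Walk.length_cons]; omega
    · intro g hg a ha
      rw [SimpleGraph.Walk.support_cons, List.mem_cons]
      rcases Finset.mem_insert.1 hg with rfl | hg
      · rcases ha.eq_or_eq_of_isLink hf with rfl | rfl
        · exact Or.inl rfl
        · exact Or.inr p.start_mem_support
      · exact Or.inr (hinc g hg a ha)
    · rw [Finset.sum_insert hfP, abs_edgeDiff_of_isLink hf]
      exact (abs_sub_le (x u) (x w) (x v)).trans (by gcongr; exact hP x)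

/-- A spanner of a multi-graph containing `e` supports a fraction `1 / t` of the energy of `e`. -/
theorem IsSpanner.edgeEnergy_le {t : ℝ} {T : Finset β} (ht : 0 ≤ t) (h : IsSpanner G t A T)
    (he : e ∈ A) (x : α → ℝ) : edgeEnergy G x e ≤ t * energy G T x := by
  classical
  by_cases hne : ∃ u v, u ≠ v ∧ G.IsLink e u v
  · obtain ⟨u, v, huv, hl⟩ := hne
    have hadj : (adjGraph G A).Adj u v :=
      (SimpleGraph.fromRel_adj _ _ _).2 ⟨huv, Or.inl ⟨e, he, hl⟩⟩
    have hd := h.2 u hl.left_mem v hl.right_mem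
    rw [SimpleGraph.edist_eq_one_iff_adj.2 hadj] at hd
    have htop : (adjGraph G T).edist u v ≠ ⊤ := by
      intro htop
      rw [htop] at hd
      simp at hd
    obtain ⟨w, hw⟩ := SimpleGraph.exists_walk_of_edist_ne_top htop
    rw [← hw] at hd
    have hwt : (w.length : ℝ) ≤ t := by
      have : ((w.length : ℕ) : ℝ≥0∞) ≤ ENNReal.ofReal t := by simpa using hd
      rwa [← ENNReal.ofReal_natCast, ENNReal.ofReal_le_ofReal_iff ht] at this
    obtain ⟨P, hPT, hcard, -, hP⟩ := exists_subset_of_isPath w.bypass w.bypass_isPath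
    have hcard' : (P.card : ℝ) ≤ t :=
      (Nat.cast_le.2 (hcard.trans w.length_bypass_le_length)).trans hwt
    calc edgeEnergy G x e = |x u - x v| ^ 2 := by rw [edgeEnergy_of_isLink hl, sq_abs]
      _ ≤ (∑ f ∈ P, |edgeDiff G f x|) ^ 2 := by gcongr; exact hP x
      _ ≤ P.card * ∑ f ∈ P, |edgeDiff G f x| ^ 2 := sq_sum_le_card_mul_sum_sq
      _ = P.card * energy G P x := by
          simp only [sq_abs, energy, edgeEnergy_eq_sq_edgeDiff]
      _ ≤ t * energy G T x :=
          mul_le_mul hcard' (energy_mono hPT x) (energy_nonneg x) ht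
  · push Not at hne
    refine le_trans (le_of_eq ?_) (mul_nonneg ht (energy_nonneg x))
    unfold edgeEnergy
    split_ifs with h
    · have : h.choose.1 = h.choose.2 := by
        by_contra h'
        exact hne _ _ h' h.choose_spec
      rw [this]; ring
    · rfl

/-- A multi-edge outside `ℓ` disjoint `t`-spanners is bypassed by `ℓ` edge-disjoint paths of length
at most `t`, and is itself one more path. -/
theorem IsDisjointSpanners.effRes_le [DecidableEq β] {t : ℝ} {ℓ : ℕ} {T : Fin ℓ → Finset β}
    (ht : 0 < t) (h : IsDisjointSpanners G t A T) (he : e ∈ A) (he' : e ∉ Finset.univ.biUnion T) :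
    effRes G A e ≤ (1 + ℓ / t)⁻¹ := by
  have hdisj : ∀ i j : Fin ℓ, i < j → Disjoint (T i) (T j) := fun i j hij =>
    Finset.disjoint_left.2 fun f hi hj => (Finset.mem_sdiff.1 ((h j).1 hj)).2
      (Finset.mem_biUnion.2 ⟨i, Finset.mem_Iio.2 hij, hi⟩)
  have hpair : ((Finset.univ : Finset (Fin ℓ)) : Set (Fin ℓ)).PairwiseDisjoint T := by
    intro i _ j _ hij
    rcases lt_or_gt_of_ne hij with h | h
    · exact hdisj i j h
    · exact (hdisj j i h).symm
  have hsub : insert e (Finset.univ.biUnion T) ⊆ A :=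
    Finset.insert_subset he (Finset.biUnion_subset.2 fun i _ =>
      (h i).1.trans Finset.sdiff_subset)
  have hpos : 0 < 1 + ℓ / t := by positivity
  refine RecursiveRecovery.effRes_le (by positivity) fun x => ?_
  rw [← div_eq_inv_mul, le_div_iff₀ hpos]
  have h1 : ∀ i, edgeEnergy G x e / t ≤ energy G (T i) x := fun i => by
    rw [div_le_iff₀' ht]
    refine (h i).edgeEnergy_le ht.le (Finset.mem_sdiff.2 ⟨he, fun hmem => he' ?_⟩) x
    exact Finset.biUnion_subset_biUnion_of_subset_left T (Finset.subset_univ _) hmem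
  calc edgeEnergy G x e * (1 + ℓ / t)
      = edgeEnergy G x e + ∑ _i : Fin ℓ, edgeEnergy G x e / t := by
        rw [Finset.sum_const, Finset.card_univ, Fintype.card_fin, nsmul_eq_mul]; ring
    _ ≤ edgeEnergy G x e + ∑ i, energy G (T i) x := by gcongr with i; exact h1 i
    _ = energy G (insert e (Finset.univ.biUnion T)) x := by
        rw [energy, Finset.sum_insert he', Finset.sum_biUnion hpair]; rfl
    _ ≤ energy G A x := energy_mono hsub x

theorem Rule.RecoversSpanners.recoversHeavy [DecidableEq β] {rule : Rule β} {E : Finset β}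
    {t θ : ℝ} {ℓ : ℕ} (ht : 0 < t) (hθ : 0 < θ) (hℓ : t / θ ≤ ℓ)
    (h : rule.RecoversSpanners G E t ℓ) : rule.RecoversHeavy G E θ := by
  intro past A hA F hF e he hheavy
  obtain ⟨T, hT, rfl⟩ := h past A hA F hF
  by_contra he'
  have h1 := hT.effRes_le ht he he'
  have h2 : θ⁻¹ ≤ ℓ / t := by
    rw [le_div_iff₀ ht, inv_mul_eq_div]; exact hℓ
  have h3 : (1 + ℓ / t)⁻¹ < θ := by
    rw [inv_lt_comm₀ (by positivity) hθ]; linarith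
  linarith

end EffectiveResistance

/-! ### The probability that the output misses `Q` -/

section Probability

theorem toOuterMeasure_add_compl {γ : Type*} (p : PMF γ) (s : Set γ) :
    p.toOuterMeasure s + p.toOuterMeasure sᶜ = 1 := by
  rw [PMF.toOuterMeasure_apply, PMF.toOuterMeasure_apply, ← ENNReal.tsum_add, ← p.tsum_coe]
  exact tsum_congr fun a => Set.indicator_self_add_compl_apply s p a

theorem toOuterMeasure_le_one {γ : Type*} (p : PMF γ) (s : Set γ) : p.toOuterMeasure s ≤ 1 :=
  le_self_add.trans_eq (toOuterMeasure_add_compl p s)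

theorem toOuterMeasure_bind_le {γ γ' : Type*} (p : PMF γ) (f : γ → PMF γ') (s : Set γ')
    {c : ℝ≥0∞} (h : ∀ a ∈ p.support, (f a).toOuterMeasure s ≤ c) :
    (p.bind f).toOuterMeasure s ≤ c := by
  rw [PMF.toOuterMeasure_bind_apply]
  calc ∑' a, p a * (f a).toOuterMeasure s ≤ ∑' a, p a * c := by
        refine ENNReal.tsum_le_tsum fun a => ?_
        by_cases ha : a ∈ p.support
        · gcongr; exact h a ha
        · rw [(p.apply_eq_zero_iff a).2 ha, zero_mul, zero_mul]
    _ = c := by rw [ENNReal.tsum_mul_right, p.tsum_coe, one_mul]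

theorem sampleHalf_apply {β : Type*} [DecidableEq β] (B D : Finset β) :
    sampleHalf B D = if D ∈ B.powerset then ((B.powerset.card : ℕ) : ℝ≥0∞)⁻¹ else 0 := by
  rw [sampleHalf]
  convert PMF.uniformOfFinset_apply (Finset.powerset_nonempty B) D

theorem toOuterMeasure_sampleHalf_bind_le {β γ : Type*} [DecidableEq β] (B : Finset β)
    (f : Finset β → PMF γ) (s : Set γ) {b : Finset β → ℝ} (hb0 : ∀ D ⊆ B, 0 ≤ b D)
    (hb : ∀ D ⊆ B, (f D).toOuterMeasure s ≤ ENNReal.ofReal (b D)) :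
    ((sampleHalf B).bind f).toOuterMeasure s
      ≤ ENNReal.ofReal ((∑ D ∈ B.powerset, b D) / 2 ^ B.card) := by
  rw [PMF.toOuterMeasure_bind_apply, tsum_eq_sum (s := B.powerset), Finset.sum_div,
    ENNReal.ofReal_sum_of_nonneg fun D hD => by
      have := hb0 D (Finset.mem_powerset.1 hD); positivity]
  · refine Finset.sum_le_sum fun D hD => ?_
    rw [sampleHalf_apply, if_pos hD, Finset.card_powerset, div_eq_inv_mul,
      ENNReal.ofReal_mul (by positivity), ENNReal.ofReal_inv_of_pos (by positivity)]
    have h2 : ENNReal.ofReal (2 ^ B.card) = ((2 ^ B.card : ℕ) : ℝ≥0∞) := by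
      rw [← ENNReal.ofReal_natCast]; norm_num
    rw [h2]
    gcongr
    exact hb D (Finset.mem_powerset.1 hD)
  · intro D hD
    rw [sampleHalf_apply, if_neg hD, zero_mul]

/-- The event that the output contains no multi-edge of `Q`. -/
def missSet {β : Type*} [DecidableEq β] (Q : Finset β) : Set (Finset β) :=
  {S | ¬ (S ∩ Q).Nonempty}

theorem hitProb_eq {β : Type*} [DecidableEq β] (rule : Rule β) (L : ℕ) (E Q : Finset β) :
    hitProb rule L E Q = 1 - ((recover rule L [] E).toOuterMeasure (missSet Q)).toReal := by
  have h := toOuterMeasure_add_compl (recover rule L [] E) {S | (S ∩ Q).Nonempty}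
  have h1 : (recover rule L [] E).toOuterMeasure {S | (S ∩ Q).Nonempty} ≠ ⊤ :=
    ne_top_of_le_ne_top ENNReal.one_ne_top (toOuterMeasure_le_one _ _)
  have h2 : (recover rule L [] E).toOuterMeasure {S | (S ∩ Q).Nonempty}ᶜ ≠ ⊤ :=
    ne_top_of_le_ne_top ENNReal.one_ne_top (toOuterMeasure_le_one _ _)
  have h3 := congrArg ENNReal.toReal h
  rw [ENNReal.toReal_add h1 h2, ENNReal.toReal_one] at h3
  rw [hitProb]
  have h4 : missSet Q = {S | (S ∩ Q).Nonempty}ᶜ := rfl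
  rw [h4]
  linarith

theorem preimage_union_missSet_of_nonempty {β : Type*} [DecidableEq β] {F Q : Finset β}
    (h : (F ∩ Q).Nonempty) : (fun S => F ∪ S) ⁻¹' missSet Q = ∅ :=
  Set.eq_empty_of_forall_notMem fun _ hS =>
    hS (h.mono (Finset.inter_subset_inter_right Finset.subset_union_left))

theorem preimage_union_missSet_of_not_nonempty {β : Type*} [DecidableEq β] {F Q : Finset β}
    (h : ¬ (F ∩ Q).Nonempty) : (fun S => F ∪ S) ⁻¹' missSet Q = missSet Q := by
  rw [Finset.not_nonempty_iff_eq_empty] at h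
  ext S
  simp [missSet, Finset.union_inter_distrib_right, h]

/-- The exponential moment of the total weight of a uniformly random subset of `C`. -/
theorem sum_exp_neg_le {β : Type*} (C : Finset β) (w : β → ℝ) {s θ η : ℝ}
    (hs : 0 ≤ s) (hη : s * θ / 2 ≤ η) (hw0 : ∀ e ∈ C, 0 ≤ w e) (hw : ∀ e ∈ C, w e ≤ θ) :
    ∑ D ∈ C.powerset, Real.exp (-(s * ∑ e ∈ D, 2 * w e))
      ≤ 2 ^ C.card * Real.exp (-(s * (1 - η) * ∑ e ∈ C, w e)) := by
  have h1 : ∀ D : Finset β, Real.exp (-(s * ∑ e ∈ D, 2 * w e))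
      = ∏ e ∈ D, Real.exp (-(s * (2 * w e))) := fun D => by
    rw [← Real.exp_sum, Finset.mul_sum, Finset.sum_neg_distrib]
  simp only [h1]
  rw [← Finset.prod_one_add, Finset.mul_sum, ← Finset.sum_neg_distrib, Real.exp_sum,
    ← Finset.prod_const, ← Finset.prod_mul_distrib]
  refine Finset.prod_le_prod (fun e _ => by positivity) fun e he => ?_
  have h0 := hw0 e he
  have hc := Real.cosh_le_exp_half_sq (s * w e)
  have hexp : 1 + Real.exp (-(s * (2 * w e)))
      = 2 * (Real.exp (-(s * w e)) * Real.cosh (s * w e)) := by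
    rw [Real.cosh_eq, mul_div_assoc', mul_div_cancel₀ _ two_ne_zero, mul_add, ← Real.exp_add,
      ← Real.exp_add]
    ring_nf
    rw [Real.exp_zero, add_comm]
  rw [hexp]
  gcongr
  calc Real.exp (-(s * w e)) * Real.cosh (s * w e)
      ≤ Real.exp (-(s * w e)) * Real.exp ((s * w e) ^ 2 / 2) := by gcongr
    _ = Real.exp (-(s * w e) + (s * w e) ^ 2 / 2) := (Real.exp_add _ _).symm
    _ ≤ _ := by
        refine Real.exp_le_exp.2 ?_
        have h2 : s * w e / 2 ≤ η := by
          have := mul_le_mul_of_nonneg_left (hw e he) hs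
          linarith
        nlinarith [mul_le_mul_of_nonneg_left h2 (mul_nonneg hs h0)]

variable {α β : Type*} [DecidableEq β] {G : Graph α β} {E Q : Finset β}

/-- Backward induction over the levels. The resistance of `Q` in the current multi-graph is nearly a
martingale, since sampling halves the multi-edges and doubles resistances, so its exponential moment
with the slowly decaying rate `lam * ((1 - η) / (1 + t)) ^ k` bounds the probability of missing `Q`;
each sampling step adds the failure probability `δ` of the spectral estimate. Multi-edges of `Q`
cannot survive to the last level unrecovered, for there they would be heavy. -/
theorem toOuterMeasure_missSet_le {rule : Rule β} {θ t lam η δ : ℝ}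
    (hrule : rule.RecoversHeavy G E θ) (ht : 0 ≤ t) (hlam : 0 ≤ lam)
    (hη : lam * θ / 2 ≤ η) (hη0 : 0 ≤ η) (hη1 : η ≤ 1) (hθ : 0 ≤ θ) (hδ : 0 ≤ δ)
    (hconc : ∀ A ⊆ E, ∀ C ⊆ A, (∀ e ∈ C, effRes G A e ≤ θ) → ∀ D : Finset (Finset β),
      D ⊆ C.powerset → (∀ B ∈ D, ¬ ∀ x, energy G B x ≤ (1 + t) / 2 * energy G A x) →
      (D.card : ℝ) ≤ 2 ^ C.card * δ)
    (k : ℕ) (past : List (Finset β × Finset β)) (A : Finset β) (hA : A ⊆ E)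
    (hinv : ∀ e ∈ Q ∩ A, effRes G A e = 0 ∨ θ ≤ effRes G A e * (2 / (1 + t)) ^ k) :
    (recover rule (k + 1) past A).toOuterMeasure (missSet Q)
      ≤ ENNReal.ofReal (Real.exp (-(lam * ((1 - η) / (1 + t)) ^ k * ∑ e ∈ Q ∩ A, effRes G A e))
        + k * δ) := by
  classical
  induction k generalizing past A with
  | zero =>
    rw [recover]
    refine toOuterMeasure_bind_le _ _ _ fun F hF => toOuterMeasure_bind_le _ _ _ fun A' _ => ?_
    rw [PMF.toOuterMeasure_map_apply]
    by_cases hFQ : (F ∩ Q).Nonempty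
    · rw [preimage_union_missSet_of_nonempty hFQ]; simp
    · refine (toOuterMeasure_le_one _ _).trans ?_
      have h0 : ∑ e ∈ Q ∩ A, effRes G A e = 0 := by
        refine Finset.sum_eq_zero fun e he => ?_
        refine (hinv e he).resolve_right fun h => hFQ ⟨e, Finset.mem_inter.2 ⟨?_, ?_⟩⟩
        · rw [pow_zero, mul_one] at h
          exact hrule past A hA F hF e (Finset.mem_inter.1 he).2 h
        · exact (Finset.mem_inter.1 he).1
      rw [h0]
      simp
  | succ k ih =>
    rw [recover]
    refine toOuterMeasure_bind_le _ _ _ fun F hF => ?_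
    by_cases hFQ : (F ∩ Q).Nonempty
    · refine toOuterMeasure_bind_le _ _ _ fun A' _ => ?_
      rw [PMF.toOuterMeasure_map_apply, preimage_union_missSet_of_nonempty hFQ]; simp
    have hlight : ∀ e ∈ A \ F, effRes G A e ≤ θ := fun e he => by
      by_contra! h
      exact (Finset.mem_sdiff.1 he).2 (hrule past A hA F hF e (Finset.mem_sdiff.1 he).1 h.le)
    set C := A \ F with hC
    have hCA : C ⊆ A := Finset.sdiff_subset
    set w : β → ℝ := fun e => if e ∈ Q then effRes G A e else 0 with hw
    have hw0 : ∀ e ∈ C, 0 ≤ w e := fun e he => by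
      simp only [hw]; split_ifs
      · exact effRes_nonneg (hCA he)
      · exact le_rfl
    have hwθ : ∀ e ∈ C, w e ≤ θ := fun e he => by
      simp only [hw]; split_ifs
      · exact hlight e he
      · exact hθ
    have hsumw : ∑ e ∈ C, w e = ∑ e ∈ Q ∩ A, effRes G A e := by
      simp only [hw]
      rw [← Finset.sum_filter]
      refine Finset.sum_congr (Finset.ext fun e => ?_) fun _ _ => rfl
      simp only [Finset.mem_filter, Finset.mem_inter, hC, Finset.mem_sdiff]
      refine ⟨fun h => ⟨h.2, h.1.1⟩, fun h => ⟨⟨h.2, fun hf => hFQ ⟨e, ?_⟩⟩, h.1⟩⟩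
      exact Finset.mem_inter.2 ⟨hf, h.1⟩
    have hr0 : 0 ≤ (1 - η) / (1 + t) := div_nonneg (by linarith) (by linarith)
    have hr1 : (1 - η) / (1 + t) ≤ 1 := div_le_one_of_le₀ (by linarith) (by linarith)
    have h1t : 0 < 1 + t := by linarith
    set r := (1 - η) / (1 + t) with hr
    set s := lam * r ^ k / (1 + t) with hs
    have hs0 : 0 ≤ s := by positivity
    have hsη : s * θ / 2 ≤ η := by
      have : s ≤ lam := by
        rw [hs, div_le_iff₀ h1t]
        nlinarith [mul_le_of_le_one_right hlam (pow_le_one₀ (n := k) hr0 hr1)]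
      have := mul_le_mul_of_nonneg_right this hθ
      linarith
    -- The bound for a sample `B`: the induction hypothesis if the spectral estimate holds for `B`,
    -- and the trivial bound `1` otherwise.
    let good : Finset β → Prop := fun B => ∀ x, energy G B x ≤ (1 + t) / 2 * energy G A x
    set b : Finset β → ℝ := fun B =>
      Real.exp (-(s * ∑ e ∈ B, 2 * w e)) + k * δ + if good B then 0 else 1 with hb
    refine (toOuterMeasure_sampleHalf_bind_le C _ _ (b := b) (fun D _ => ?_)
      fun D hD => ?_).trans (ENNReal.ofReal_le_ofReal ?_)
    · simp only [hb]; split_ifs <;> positivity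
    · rw [PMF.toOuterMeasure_map_apply, preimage_union_missSet_of_not_nonempty hFQ]
      have hDA : D ⊆ A := hD.trans hCA
      by_cases hgood : good D
      · have hR : ∀ e ∈ D, 2 / (1 + t) * effRes G A e ≤ effRes G D e := fun e he => by
          have := effRes_le_mul_effRes (by positivity) he hgood
          rw [div_mul_eq_mul_div, div_le_iff₀ h1t]
          linarith
        refine (ih ((A, F) :: past) D (hDA.trans hA) fun e he => ?_).trans
          (ENNReal.ofReal_le_ofReal ?_)
        · obtain ⟨heQ, heD⟩ := Finset.mem_inter.1 he
          rcases hinv e (Finset.mem_inter.2 ⟨heQ, hDA heD⟩) with h | h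
          · exact Or.inl (effRes_eq_zero_of_subset hDA heD h)
          · right
            refine h.trans ?_
            rw [pow_succ', ← mul_assoc]
            gcongr
            rw [mul_comm]
            exact hR e heD
        · simp only [hb, if_pos hgood, add_zero]
          have hsum : ∑ e ∈ D, 2 * w e = ∑ e ∈ Q ∩ D, 2 * effRes G A e := by
            simp only [hw, mul_ite, mul_zero]
            rw [← Finset.sum_filter]
            refine Finset.sum_congr (Finset.ext fun e => ?_) fun _ _ => rfl
            rw [Finset.mem_filter, Finset.mem_inter, and_comm]
          have hle : s * ∑ e ∈ D, 2 * w e ≤ lam * r ^ k * ∑ e ∈ Q ∩ D, effRes G D e := by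
            rw [hsum, hs, div_mul_eq_mul_div, mul_div_assoc, Finset.sum_div]
            refine mul_le_mul_of_nonneg_left (Finset.sum_le_sum fun e he => ?_) (by positivity)
            refine le_trans (le_of_eq ?_) (hR e (Finset.mem_inter.1 he).2)
            ring
          have := Real.exp_le_exp.2 (neg_le_neg hle)
          linarith
      · refine (toOuterMeasure_le_one _ _).trans ?_
        rw [← ENNReal.ofReal_one]
        refine ENNReal.ofReal_le_ofReal ?_
        simp only [hb, if_neg hgood]
        have : 0 ≤ Real.exp (-(s * ∑ e ∈ D, 2 * w e)) + k * δ := by positivity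
        linarith
    · have h1 := sum_exp_neg_le C w hs0 hsη hw0 hwθ
      have h2 : ∑ B ∈ C.powerset, (if good B then (0 : ℝ) else 1) ≤ 2 ^ C.card * δ := by
        refine le_trans (le_of_eq ?_) (hconc A hA C hCA hlight (C.powerset.filter fun B => ¬ good B)
          (Finset.filter_subset _ _) fun B hB => (Finset.mem_filter.1 hB).2)
        rw [Finset.card_filter, Nat.cast_sum]
        refine Finset.sum_congr rfl fun B _ => ?_
        by_cases h : good B <;> simp [h]
      have h3 : s * (1 - η) = lam * r ^ (k + 1) := by
        rw [hs, pow_succ, hr]; ring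
      rw [div_le_iff₀ (by positivity)]
      simp only [hb, Finset.sum_add_distrib, Finset.sum_const, Finset.card_powerset, nsmul_eq_mul]
      rw [h3, hsumw] at h1
      push_cast
      linarith

end Probability

/-! ### Choice of the parameters -/

theorem min_two_thirds_le_one_sub_exp {x : ℝ} (hx : 0 ≤ x) :
    min (2 / 3) x ≤ 1 - Real.exp (-(3 * x)) := by
  have h1 : 1 + 3 * x ≤ Real.exp (3 * x) := by linarith [Real.add_one_le_exp (3 * x)]
  have h2 : Real.exp (-(3 * x)) ≤ (1 + 3 * x)⁻¹ := by
    rw [Real.exp_neg]; exact inv_anti₀ (by positivity) h1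
  have h3 : (1 + 3 * x)⁻¹ * (1 + 3 * x) = 1 := inv_mul_cancel₀ (by positivity)
  have h0 : 0 < (1 + 3 * x)⁻¹ := by positivity
  rcases le_total x (2 / 3) with h | h
  · refine (min_le_right _ _).trans ?_
    nlinarith [mul_nonneg h0.le (mul_nonneg hx (by linarith : 0 ≤ 2 - 3 * x))]
  · refine (min_le_left _ _).trans ?_
    nlinarith [mul_nonneg h0.le (by linarith : 0 ≤ 3 * x - 2)]

theorem mul_half_pow_ceil_le {n : ℕ} (hn : 2 ≤ n) :
    (n : ℝ) * (1 / 2) ^ ⌈21 * Real.logb 2 n⌉₊ ≤ 1 / (n : ℝ) ^ 20 := by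
  have hn0 : (0 : ℝ) < n := by positivity
  have h1 : (n : ℝ) ^ 21 ≤ 2 ^ ⌈21 * Real.logb 2 n⌉₊ := by
    calc (n : ℝ) ^ 21 = ((2 : ℝ) ^ Real.logb 2 n) ^ (21 : ℕ) := by
          rw [Real.rpow_logb (by norm_num) (by norm_num) hn0]
      _ = (2 : ℝ) ^ (21 * Real.logb 2 n) := by
          rw [← Real.rpow_natCast, ← Real.rpow_mul (by norm_num), mul_comm]; norm_num
      _ ≤ (2 : ℝ) ^ ((⌈21 * Real.logb 2 n⌉₊ : ℕ) : ℝ) :=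
          Real.rpow_le_rpow_of_exponent_le (by norm_num) (Nat.le_ceil _)
      _ = _ := Real.rpow_natCast _ _
  rw [one_div_pow, mul_one_div, div_le_div_iff₀ (by positivity) (by positivity)]
  calc (n : ℝ) * n ^ 20 = n ^ 21 := by ring
    _ ≤ _ := by rw [one_mul]; exact h1

theorem le_hitProb_of_recoversHeavy {α β : Type*} [DecidableEq β] (G : Graph α β) (n m L : ℕ)
    (ε : ℝ) (E Q : Finset β) (hV : V(G).encard = n) (hEm : E.card ≤ m)
    (hn : 2 ≤ n) (hm : 2 ≤ m) (hε : 0 < ε) (hε1 : ε ≤ 1)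
    (hL : |(L : ℝ) - Real.logb 2 m| < 1) (hQ : Q ⊆ E) (rule : Rule β)
    (hrule : rule.RecoversHeavy G E (ε ^ 2 / (1000 * Real.logb 2 n * Real.logb 2 m ^ 2))) :
    min (2 / 3) ((∑ e ∈ Q, effRes G E e) / ε ^ 2) - Real.logb 2 m / (n : ℝ) ^ 20
      ≤ hitProb rule L E Q := by
  have hlogb : ∀ j : ℕ, 2 ≤ j → 1 ≤ Real.logb 2 j := fun j hj => by
    rw [Real.le_logb_iff_rpow_le (by norm_num) (by positivity), Real.rpow_one]
    exact_mod_cast hj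
  have hpm : (2 : ℝ) ^ Real.logb 2 m = m :=
    Real.rpow_logb (by norm_num) (by norm_num) (by positivity)
  have hp := mul_half_pow_ceil_le hn
  have hln := hlogb n hn
  have hlm := hlogb m hm
  set a := Real.logb 2 n with ha
  set b := Real.logb 2 m with hb
  have ha0 : 0 < a := by linarith
  have hb0 : 0 < b := by linarith
  have hm0 : (0 : ℝ) < m := by positivity
  have hε2 : ε ^ 2 ≤ 1 := pow_le_one₀ hε.le hε1
  rw [abs_lt] at hL
  obtain ⟨k, rfl⟩ : ∃ k, L = k + 1 := by
    refine Nat.exists_eq_succ_of_ne_zero fun h => ?_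
    rw [h, Nat.cast_zero] at hL
    linarith [hL.1]
  push_cast at hL
  have hkb : (k : ℝ) ≤ b := by linarith
  set θ := ε ^ 2 / (1000 * a * b ^ 2) with hθ
  have hθ0 : 0 < θ := by positivity
  -- Per-level loss in the spectral estimate and in the exponential rate; both are of order
  -- `1 / log m`, so that over all levels they cost a constant factor only.
  set t := 3 / (10 * b) with ht
  set η := 1 / (10 * b) with hη
  -- The rate at the last level: the largest with `lam * θ / 2 ≤ η`.
  set lam := 2 * η / θ with hlam
  -- The moment order that makes the failure probability of one level at most `1 / n ^ 20`.
  set p := ⌈21 * a⌉₊ with hpdef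
  have ht0 : 0 < t := by positivity
  have hη0 : 0 < η := by positivity
  have hη1 : η ≤ 1 := by
    rw [hη, div_le_one (by positivity)]; linarith
  have ht1 : t ≤ 1 := by
    rw [ht, div_le_one (by positivity)]; linarith
  have hkt : k * t ≤ 3 / 10 := by
    rw [ht, mul_div_assoc', div_le_div_iff₀ (by positivity) (by norm_num)]; linarith
  have hkη : k * η ≤ 1 / 10 := by
    rw [hη, mul_div_assoc', div_le_div_iff₀ (by positivity) (by norm_num)]; linarith
  have hpa : (p : ℝ) ≤ 22 * a := by
    have := Nat.ceil_lt_add_one (by positivity : 0 ≤ 21 * a)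
    linarith
  have hbase : 2 * p * θ / t ^ 2 ≤ 1 / 2 := by
    calc 2 * p * θ / t ^ 2 ≤ 2 * (22 * a) * θ / t ^ 2 := by gcongr
      _ = 44 / 90 * ε ^ 2 := by rw [hθ, ht]; field_simp; norm_num
      _ ≤ 1 / 2 := by linarith
  have hconc : ∀ A ⊆ E, ∀ C ⊆ A, (∀ e ∈ C, effRes G A e ≤ θ) → ∀ D : Finset (Finset β),
      D ⊆ C.powerset → (∀ B ∈ D, ¬ ∀ x, energy G B x ≤ (1 + t) / 2 * energy G A x) →
      (D.card : ℝ) ≤ 2 ^ C.card * (1 / (n : ℝ) ^ 20) := by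
    classical
    intro A _ C hC hlight D hD hbad
    calc (D.card : ℝ) ≤ ((C.powerset.filter fun B =>
            ¬ ∀ x, energy G B x ≤ (1 + t) / 2 * energy G A x).card : ℝ) :=
          Nat.cast_le.2 (Finset.card_le_card fun B hB => Finset.mem_filter.2 ⟨hD hB, hbad B hB⟩)
      _ ≤ 2 ^ C.card * (n * (2 * p * θ / t ^ 2) ^ p) :=
          card_filter_not_energy_le hV hC hθ0.le hlight ht0 p
      _ ≤ 2 ^ C.card * (n * (1 / 2) ^ p) := by gcongr
      _ ≤ _ := by gcongr
  have h1t : 1 - t ≤ 1 / (1 + t) := by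
    rw [le_div_iff₀ (by positivity)]; nlinarith
  have hinv : ∀ e ∈ Q ∩ E, effRes G E e = 0 ∨ θ ≤ effRes G E e * (2 / (1 + t)) ^ k := by
    intro e he
    refine (effRes_eq_zero_or_inv_le (Finset.mem_inter.1 he).2 hEm).imp_right fun h => ?_
    -- At the last level `e` would have resistance at least `7 / 40`, far above `θ`.
    have h2k : (m : ℝ) / 4 ≤ 2 ^ k := by
      calc (m : ℝ) / 4 = (2 : ℝ) ^ (b - 2) := by
            rw [Real.rpow_sub (by norm_num), hpm]; norm_num
        _ ≤ (2 : ℝ) ^ (k : ℝ) :=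
            Real.rpow_le_rpow_of_exponent_le (by norm_num) (by linarith)
        _ = 2 ^ k := Real.rpow_natCast _ _
    -- Over all levels the factors `1 / (1 + t)` cost a constant only (Bernoulli's inequality).
    have hpow : 7 / 10 ≤ (1 / (1 + t)) ^ k := by
      calc (7 / 10 : ℝ) ≤ 1 + k * (-t) := by linarith
        _ ≤ (1 + -t) ^ k := one_add_mul_le_pow (by linarith) k
        _ ≤ (1 / (1 + t)) ^ k := by
            refine pow_le_pow_left₀ (by linarith) ?_ k
            linarith
    have hR0 : 0 ≤ effRes G E e := effRes_nonneg (Finset.mem_inter.1 he).2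
    calc θ ≤ 1 / 10 := by
          rw [hθ, div_le_div_iff₀ (by positivity) (by norm_num)]
          nlinarith [mul_le_mul hln (one_le_pow₀ hlm : 1 ≤ b ^ 2) zero_le_one ha0.le]
      _ ≤ (m : ℝ)⁻¹ * ((m / 4) * (7 / 10)) := by field_simp; norm_num
      _ ≤ effRes G E e * (2 ^ k * (1 / (1 + t)) ^ k) := by gcongr
      _ = effRes G E e * (2 / (1 + t)) ^ k := by rw [← mul_pow, mul_one_div]
  have hmiss := toOuterMeasure_missSet_le hrule ht0.le (by positivity : 0 ≤ lam)
    (by rw [hlam, div_mul_cancel₀ _ hθ0.ne']; linarith : lam * θ / 2 ≤ η) hη0.le hη1 hθ0.le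
    (by positivity) hconc k [] E subset_rfl hinv
  rw [Finset.inter_eq_left.2 hQ] at hmiss
  set Z := ∑ e ∈ Q, effRes G E e with hZ
  have hZ0 : 0 ≤ Z := Finset.sum_nonneg fun e he => effRes_nonneg (hQ he)
  have hrate : 3 / ε ^ 2 ≤ lam * ((1 - η) / (1 + t)) ^ k := by
    have hpow : 6 / 10 ≤ ((1 - η) / (1 + t)) ^ k := by
      have h1 : 1 + -(η + t) ≤ (1 - η) / (1 + t) := by
        rw [le_div_iff₀ (by positivity)]; nlinarith
      have hηt : η + t ≤ 1 := by
        rw [hη, ht, ← add_div, div_le_one (by positivity)]; linarith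
      calc (6 / 10 : ℝ) ≤ 1 + k * (-(η + t)) := by linarith
        _ ≤ (1 + -(η + t)) ^ k := one_add_mul_le_pow (by linarith) k
        _ ≤ _ := pow_le_pow_left₀ (by linarith) h1 k
    have hl : lam = 200 * (a * b) / ε ^ 2 := by
      rw [hlam, hη, hθ]; field_simp; norm_num
    calc 3 / ε ^ 2 ≤ 200 * (a * b) / ε ^ 2 * (6 / 10) := by
          rw [div_mul_eq_mul_div]
          gcongr
          nlinarith
      _ ≤ lam * ((1 - η) / (1 + t)) ^ k := by rw [← hl]; gcongr
  have hmiss' : ((recover rule (k + 1) [] E).toOuterMeasure (missSet Q)).toReal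
      ≤ Real.exp (-(3 * (Z / ε ^ 2))) + b / (n : ℝ) ^ 20 := by
    refine (ENNReal.toReal_le_of_le_ofReal (by positivity) hmiss).trans ?_
    refine add_le_add (Real.exp_le_exp.2 (neg_le_neg ?_)) ?_
    · calc 3 * (Z / ε ^ 2) = 3 / ε ^ 2 * Z := by ring
        _ ≤ _ := by gcongr
    · rw [mul_one_div]; gcongr
  rw [hitProb_eq]
  have := min_two_thirds_le_one_sub_exp (div_nonneg hZ0 (sq_nonneg ε))
  linarith

end RecursiveRecovery

theorem mainTheorem11 {α β : Type*} [DecidableEq β] (G : Graph α β) (n m L : ℕ) (ε : ℝ)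
    (E Q : Finset β) (hE : (E : Set β) = E(G)) (hV : V(G).encard = n) (hEm : E.card ≤ m)
    (hn : 2 ≤ n) (hm : 2 ≤ m) (hε : 0 < ε) (hε1 : ε ≤ 1)
    (hL : |(L : ℝ) - Real.logb 2 m| < 1) (hQ : Q ⊆ E) :
    (∀ rule : RecursiveRecovery.Rule β,
      rule.RecoversHeavy G E (ε ^ 2 / (1000 * Real.logb 2 n * Real.logb 2 m ^ 2)) →
        min (2 / 3) ((∑ e ∈ Q, RecursiveRecovery.effRes G E e) / ε ^ 2)
            - Real.logb 2 m / (n : ℝ) ^ 20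
          ≤ RecursiveRecovery.hitProb rule L E Q) ∧
    (∀ (ℓ : ℕ) (rule : RecursiveRecovery.Rule β),
      1000 * Real.logb 2 n ^ 2 * Real.logb 2 m ^ 2 / ε ^ 2 ≤ ℓ →
      rule.RecoversSpanners G E (Real.logb 2 n) ℓ →
        min (2 / 3) ((∑ e ∈ Q, RecursiveRecovery.effRes G E e) / ε ^ 2)
            - Real.logb 2 m / (n : ℝ) ^ 20
          ≤ RecursiveRecovery.hitProb rule L E Q) := by
  have hheavy := RecursiveRecovery.le_hitProb_of_recoversHeavy G n m L ε E Q hV hEm hn hm hε hε1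
    hL hQ
  refine ⟨hheavy, fun ℓ rule hℓ hrule => hheavy rule ?_⟩
  have ha : 0 < Real.logb 2 n := Real.logb_pos (by norm_num) (by exact_mod_cast hn)
  have hb : 0 < Real.logb 2 m := Real.logb_pos (by norm_num) (by exact_mod_cast hm)
  refine hrule.recoversHeavy ha (by positivity) (le_trans (le_of_eq ?_) hℓ)
  field_simp
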